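/- Proposition. For a smooth embedded hypersurface $\Sigma^n\subset\mathbb{R}^{n+1}$ with local unit normal $\mathbf n$, let $d\mu$ be the $n$-dimensional area measure of $\Sigma$, let $\nabla$ and $\Delta$ be the gradient and Laplace operator of $\Sigma$, let $A$ be the second fundamental form and $H=\operatorname{div}_\Sigma\mathbf n$ the mean curvature. $\Sigma$ is a self-shrinker if $H=\frac12\langle x,\mathbf n\rangle$ at each $x\in\Sigma$. Its entropy is $$\lambda(\Sigma)=\sup_{x_0\in\mathbb{R}^{n+1},\,t_0>0}(4\pi t_0)^{-n/2}\int_\Sigma e^{-|x-x_0|^2/(4t_0)}\,d\mu .$$ Put $\rho=e^{-|x|^2/4}$ and $L=\Delta-\frac12\langle x,\nabla\cdot\rangle+|A|^2+\frac12$. A self-shrinker $\Sigma$ is $\delta$-stable in a domain $\Omega\subset\mathbb{R}^{n+1}$ if, for every smooth function $\phi$ on $\mathbb{R}^{n+1}$ with compact support in $\Omega$, the function $\phi\,L\phi\,\rho$ is integrable on $\Sigma$ (automatic if $\Sigma$ is closed in $\mathbb{R}^{n+1}$) and $$\int_\Sigma(-\phi\,L\phi)\,\rho\,d\mu+\delta\int_\Sigma\phi^2\rho\,d\mu\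 \ge\ 0 .$$ Let $n\ge 2$ and $\lambda_0\in\mathbb{R}$. There is a constant $C=C(n,\lambda_0)$ such that the following holds. If $\Sigma^n\subset\mathbb{R}^{n+1}$ is a smooth embedded self-shrinker with $\lambda(\Sigma)\le\lambda_0$ that is $\frac12$-stable in the open ball of radius $R$ centered at the origin, for some $R>1$, then $$\int_{B_{R-1}\cap\Sigma}|A|^2\,d\mu\ \le\ C\,R^n e^{-R/4},$$ where $B_{R-1}$ is the closed ball of radius $R-1$ centered at the origin. -/

import Mathlib

open Set Filter Topology MeasureTheory
open scoped ContDiff InnerProductSpace NNReal ENNReal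

noncomputable section

namespace Shrinker

/-- The ambient Euclidean space of dimension `n + 1`. -/
abbrev Amb (n : ℕ) : Type := EuclideanSpace ℝ (Fin (n + 1))

/-- `S` is a smooth embedded hypersurface: near each of its points it is the zero set of a smooth
function without critical points. -/
def IsSmoothHypersurface {n : ℕ} (S : Set (Amb n)) : Prop :=
  ∀ p ∈ S, ∃ (U : Set (Amb n)) (f : Amb n → ℝ), IsOpen U ∧ p ∈ U ∧ ContDiffOn ℝ ∞ f U ∧
    (∀ q ∈ U, fderiv ℝ f q ≠ 0) ∧ S ∩ U = {q ∈ U | f q = 0}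

/-- `ν` is, near `p`, a smooth extension to the ambient space of a unit normal field along `S`
(on a smooth hypersurface, `tangentConeAt ℝ S q` is the tangent space at `q`). -/
structure IsLocalUnitNormal {n : ℕ} (S : Set (Amb n)) (p : Amb n) (ν : Amb n → Amb n) : Prop where
  smooth : ContDiffAt ℝ ∞ ν p
  unit : ∀ᶠ q in 𝓝[S] p, ‖ν q‖ = 1
  normal : ∀ᶠ q in 𝓝[S] p, ∀ v ∈ tangentConeAt ℝ S q, ⟪v, ν q⟫_ℝ = 0

/-- For a unit vector `w`, the orthogonal projection `v ↦ v - ⟪w, v⟫ w` onto the hyperplane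
orthogonal to `w`. -/
def tangentProj {n : ℕ} (w : Amb n) : Amb n →L[ℝ] Amb n :=
  ContinuousLinearMap.id ℝ (Amb n) - (innerSL ℝ w).smulRight w

/-- The restriction to the tangent space, followed by the projection to the tangent space, of the
differential at `p` of a vector field `X`; here `ν` is a local unit normal field. -/
def tangentDeriv {n : ℕ} (ν X : Amb n → Amb n) (p : Amb n) : Amb n →L[ℝ] Amb n :=
  tangentProj (ν p) ∘L fderiv ℝ X p ∘L tangentProj (ν p)

/-- The tangential divergence `div_Σ X = ∑ ⟪D_{eᵢ} X, eᵢ⟫`, with `eᵢ` an orthonormal basis of the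
tangent space. -/
def surfaceDiv {n : ℕ} (ν X : Amb n → Amb n) (p : Amb n) : ℝ :=
  LinearMap.trace ℝ (Amb n) (tangentDeriv ν X p).toLinearMap

/-- The mean curvature `H = div_Σ 𝐧`. -/
def meanCurvature {n : ℕ} (ν : Amb n → Amb n) (p : Amb n) : ℝ :=
  surfaceDiv ν ν p

/-- `|A|²`, the squared Hilbert-Schmidt norm of the shape operator `v ↦ D_v 𝐧` of the tangent
space. -/
def normSqA {n : ℕ} (ν : Amb n → Amb n) (p : Amb n) : ℝ :=
  ∑ i : Fin (n + 1), ‖tangentDeriv ν ν p (EuclideanSpace.single i 1)‖ ^ 2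

/-- The gradient `∇φ` on the hypersurface: the tangential part of the ambient gradient. -/
def surfaceGrad {n : ℕ} (ν : Amb n → Amb n) (φ : Amb n → ℝ) (q : Amb n) : Amb n :=
  tangentProj (ν q) (gradient φ q)

/-- The Laplace operator of the hypersurface, `Δ φ = div_Σ ∇φ`. -/
def surfaceLaplacian {n : ℕ} (ν : Amb n → Amb n) (φ : Amb n → ℝ) (p : Amb n) : ℝ :=
  surfaceDiv ν (surfaceGrad ν φ) p

/-- The stability operator `L φ = Δ φ - ½ ⟪x, ∇φ⟫ + |A|² φ + ½ φ`. -/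
def stabilityOp {n : ℕ} (ν : Amb n → Amb n) (φ : Amb n → ℝ) (p : Amb n) : ℝ :=
  surfaceLaplacian ν φ p - 1 / 2 * ⟪p, surfaceGrad ν φ p⟫_ℝ + normSqA ν p * φ p + 1 / 2 * φ p

open Classical in
/-- A choice of a local unit normal field of `S` near `p`. It is unique on `S` near `p` up to sign,
and neither `|A|²` nor `L` depends on the sign. -/
def localNormal {n : ℕ} (S : Set (Amb n)) (p : Amb n) : Amb n → Amb n :=
  if h : ∃ ν, IsLocalUnitNormal S p ν then h.choose else 0

/-- `|A|²` of the hypersurface `S` at `p`. -/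
def sqNormSecondFundForm {n : ℕ} (S : Set (Amb n)) (p : Amb n) : ℝ :=
  normSqA (localNormal S p) p

/-- `L φ` on the hypersurface `S` at `p`. -/
def stabilityOperator {n : ℕ} (S : Set (Amb n)) (φ : Amb n → ℝ) (p : Amb n) : ℝ :=
  stabilityOp (localNormal S p) φ p

/-- A smooth embedded self-shrinker: `H = ½ ⟪x, 𝐧⟫` (the equation does not depend on the sign
of `𝐧`). -/
structure IsSelfShrinker {n : ℕ} (S : Set (Amb n)) : Prop where
  hypersurface : IsSmoothHypersurface S
  shrinker : ∀ p ∈ S, ∀ ν, IsLocalUnitNormal S p ν → meanCurvature ν p = 1 / 2 * ⟪p, ν p⟫_ℝ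

/-- The area measure of `S`: the `n`-dimensional Hausdorff measure, normalized so as to agree with
Lebesgue measure on `n`-planes, restricted to `S`. -/
def area {n : ℕ} (S : Set (Amb n)) : Measure (Amb n) := (μHE[n]).restrict S

/-- `F_{x₀,t₀}(S) = (4πt₀)^{-n/2} ∫_S exp(-|x-x₀|²/(4t₀))`, in `[0,∞]`. -/
def gaussianArea {n : ℕ} (S : Set (Amb n)) (x₀ : Amb n) (t₀ : ℝ) : ℝ≥0∞ :=
  ENNReal.ofReal ((4 * Real.pi * t₀) ^ (-(n : ℝ) / 2)) *
    ∫⁻ x, ENNReal.ofReal (Real.exp (-‖x - x₀‖ ^ 2 / (4 * t₀))) ∂(area S)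

/-- The entropy `λ(S)`. -/
def entropy {n : ℕ} (S : Set (Amb n)) : ℝ≥0∞ :=
  ⨆ (x₀ : Amb n) (t₀ : ℝ) (_ : 0 < t₀), gaussianArea S x₀ t₀

/-- The weight `ρ = exp(-|x|²/4)`. -/
def weight {n : ℕ} (x : Amb n) : ℝ := Real.exp (-‖x‖ ^ 2 / 4)

/-- `S` is `δ`-stable in `Ω`: `∫_S (-φ L φ) ρ + δ ∫_S φ² ρ ≥ 0` for all smooth `φ` with compact
support in `Ω`. The integrability of `φ L φ ρ` is included so that the first integral has
its proper meaning; it is automatic when `S` is closed and of locally finite area. -/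
def IsStableIn {n : ℕ} (S : Set (Amb n)) (δ : ℝ) (Ω : Set (Amb n)) : Prop :=
  ∀ φ : Amb n → ℝ, ContDiff ℝ ∞ φ → HasCompactSupport φ → tsupport φ ⊆ Ω →
    Integrable (fun x => -φ x * stabilityOperator S φ x * weight x) (area S) ∧
    0 ≤ ∫ x, -φ x * stabilityOperator S φ x * weight x ∂(area S) +
      δ * ∫ x, φ x ^ 2 * weight x ∂(area S)

end Shrinker

end

/-!
The estimate comes from testing stability on a radial cutoff, without integrating by parts; no
boundary terms arise, so the hypersurface need not be closed.

For `φ = h (‖x‖²)` the Gauss formula gives `Δ φ = tr_Σ D²φ - H ⟪𝐧, Dφ⟫`, and on a self-shrinker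
the `H` term cancels the normal part of `½ ⟪x, Dφ⟫` (`stabilityOp_radial`). Hence
`L φ = tr_Σ D²φ - ½ ⟪x, Dφ⟫ + |A|² φ + ½ φ`, where the first two terms are at most a multiple of
`R²` if the derivatives of `h` are bounded. Take `φ` equal to `1` on the ball of radius `R - 1/4`
and to `0` off the ball of radius `R - 1/8` (`exists_radial_cutoff`). In the `½`-stability
inequality the terms `½ φ² ρ` cancel, which leaves
`∫_{B_{R-1}} |A|² ρ ≤ C R² e^{-(R-1/4)²/4} area (Σ ∩ B_R)` (`lintegral_ball_le_of_stable`).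

On `B_{R-1}` the weight is at least `e^{-(R-1)²/4}`, and the quotient of the two exponentials is of
order `e^{-3R/8}`, which beats `e^{-R/4}` by enough to absorb `R²` (`sq_mul_exp_le`). The area is
bounded by `C λ₀ Rⁿ`, by the entropy at the centre `0` and the scale `R²` (`area_ball_le`).
-/

namespace Shrinker

/-! ### Smooth hypersurfaces -/

theorem IsSmoothHypersurface.measurableSet {n : ℕ} {S : Set (Amb n)}
    (hS : IsSmoothHypersurface S) : MeasurableSet S := by
  choose! U f hUo hpU hf _ hSU using hS
  -- `S` is relatively closed in the union of the charts `U p`, hence locally closed.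
  have key : S = closure S ∩ ⋃ p ∈ S, U p := by
    refine Subset.antisymm
      (fun p hp => ⟨subset_closure hp, mem_biUnion hp (hpU p hp)⟩) ?_
    rintro q ⟨hq, hqU⟩
    obtain ⟨p, hp, hqp⟩ := mem_iUnion₂.1 hqU
    have hcont : ContinuousAt (f p) q :=
      (hf p hp).continuousOn.continuousAt ((hUo p hp).mem_nhds hqp)
    have hzero : f p q = 0 := by
      have hne : (𝓝[S] q).NeBot := mem_closure_iff_nhdsWithin_neBot.1 hq
      refine tendsto_nhds_unique (hcont.tendsto.mono_left nhdsWithin_le_nhds)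
        (tendsto_const_nhds.congr' ?_ : Tendsto (f p) (𝓝[S] q) (𝓝 0))
      filter_upwards [self_mem_nhdsWithin,
        mem_nhdsWithin_of_mem_nhds ((hUo p hp).mem_nhds hqp)] with x hxS hxU
      have hx : x ∈ S ∩ U p := ⟨hxS, hxU⟩
      rw [hSU p hp] at hx
      exact hx.2.symm
    have hq' : q ∈ S ∩ U p := by
      rw [hSU p hp]
      exact ⟨hqp, hzero⟩
    exact hq'.1
  rw [key]
  exact isClosed_closure.measurableSet.inter
    (isOpen_biUnion fun p hp => hUo p hp).measurableSet

/-- The derivative maps tangent vectors of `s` at `x` to tangent vectors of the image under `f` of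
a neighbourhood of `x` in `s`, which is contained in a single point. -/
theorem fderiv_eq_zero_of_mem_tangentConeAt {E F : Type*} [NormedAddCommGroup E]
    [NormedSpace ℝ E] [NormedAddCommGroup F] [NormedSpace ℝ F] {f : E → F} {s : Set E} {x v : E}
    (hf : DifferentiableAt ℝ f x) (h0 : ∀ᶠ y in 𝓝[s] x, f y = 0) (hv : v ∈ tangentConeAt ℝ s x) :
    fderiv ℝ f x v = 0 := by
  set t : Set E := {y ∈ s | f y = 0}
  have ht : 𝓝[s] x ≤ 𝓝[t] x :=
    le_inf inf_le_left (le_principal_iff.2 (by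
      filter_upwards [self_mem_nhdsWithin, h0] with y hy hy0 using ⟨hy, hy0⟩))
  have himage : f '' t ⊆ {0} := by
    rintro _ ⟨y, hy, rfl⟩
    exact hy.2
  have hmem : fderiv ℝ f x v ∈ tangentConeAt ℝ (f '' t) (f x) :=
    (hf.hasFDerivAt.hasFDerivWithinAt (s := t)).mapsTo_tangent_cone
      (tangentConeAt_mono_nhds ht hv)
  refine tangentConeAt_subset_zero (fun hacc => ?_) hmem
  exact Set.Infinite.of_accPt hacc ((finite_singleton 0).subset himage)

/-- Where `S` is the zero set of a submersion `f`, the normalized gradient of `f` is a local unit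
normal field. -/
theorem IsSmoothHypersurface.exists_isLocalUnitNormal {n : ℕ} {S : Set (Amb n)}
    (hS : IsSmoothHypersurface S) {p : Amb n} (hp : p ∈ S) : ∃ ν, IsLocalUnitNormal S p ν := by
  obtain ⟨U, f, hUo, hpU, hf, hf0, hSU⟩ := hS p hp
  have hgrad : ∀ q ∈ U, gradient f q ≠ 0 := fun q hq h =>
    hf0 q hq ((InnerProductSpace.toDual ℝ (Amb n)).symm.map_eq_zero_iff.1 h)
  have hU : U ∈ 𝓝 p := hUo.mem_nhds hpU
  have hsmooth : ContDiffAt ℝ ∞ (gradient f) p :=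
    (InnerProductSpace.toDual ℝ (Amb n)).symm.toContinuousLinearEquiv.contDiff.contDiffAt.comp p
      ((hf.contDiffAt hU).fderiv_right (m := ∞) (by simp))
  refine ⟨fun q => ‖gradient f q‖⁻¹ • gradient f q, ?_, ?_, ?_⟩
  · exact ((hsmooth.norm ℝ (hgrad p hpU)).inv (norm_ne_zero_iff.2 (hgrad p hpU))).smul hsmooth
  · filter_upwards [mem_nhdsWithin_of_mem_nhds hU] with q hq
    exact norm_smul_inv_norm (𝕜 := ℝ) (hgrad q hq)
  · filter_upwards [mem_nhdsWithin_of_mem_nhds hU] with q hq v hv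
    have hdiff : DifferentiableAt ℝ f q :=
      (hf.contDiffAt (hUo.mem_nhds hq)).differentiableAt (by simp)
    have h0 : fderiv ℝ f q v = 0 := by
      refine fderiv_eq_zero_of_mem_tangentConeAt hdiff ?_ hv
      filter_upwards [self_mem_nhdsWithin,
        mem_nhdsWithin_of_mem_nhds (hUo.mem_nhds hq)] with x hxS hxU
      have hx : x ∈ S ∩ U := ⟨hxS, hxU⟩
      rw [hSU] at hx
      exact hx.2
    rw [inner_smul_right, real_inner_comm, ← hdiff.hasGradientAt.fderiv_apply, h0, mul_zero]

theorem IsSmoothHypersurface.isLocalUnitNormal_localNormal {n : ℕ} {S : Set (Amb n)}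
    (hS : IsSmoothHypersurface S) {p : Amb n} (hp : p ∈ S) :
    IsLocalUnitNormal S p (localNormal S p) := by
  have h := hS.exists_isLocalUnitNormal hp
  rw [localNormal, dif_pos h]
  exact h.choose_spec

/-! ### The drift Laplacian of a radial function -/

theorem tangentProj_apply {n : ℕ} (w v : Amb n) : tangentProj w v = v - ⟪w, v⟫_ℝ • w := rfl

theorem tangentProj_self {n : ℕ} {w : Amb n} (hw : ‖w‖ = 1) : tangentProj w w = 0 := by
  simp [tangentProj_apply, hw]

theorem tangentProj_tangentProj {n : ℕ} {w : Amb n} (hw : ‖w‖ = 1) (v : Amb n) :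
    tangentProj w (tangentProj w v) = tangentProj w v := by
  rw [tangentProj_apply w v, map_sub, map_smul, tangentProj_self hw, smul_zero, sub_zero,
    tangentProj_apply]

theorem inner_tangentProj_comm {n : ℕ} (w u v : Amb n) :
    ⟪u, tangentProj w v⟫_ℝ = ⟪tangentProj w u, v⟫_ℝ := by
  simp only [tangentProj_apply, inner_sub_left, inner_sub_right, inner_smul_left,
    inner_smul_right, RCLike.conj_to_real, real_inner_comm u w]
  ring

theorem norm_tangentProj_sq {n : ℕ} {w : Amb n} (hw : ‖w‖ = 1) (v : Amb n) :
    ‖tangentProj w v‖ ^ 2 = ‖v‖ ^ 2 - ⟪w, v⟫_ℝ ^ 2 := by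
  rw [← real_inner_self_eq_norm_sq, ← inner_tangentProj_comm, tangentProj_tangentProj hw,
    tangentProj_apply, inner_sub_right, inner_smul_right, real_inner_self_eq_norm_sq,
    real_inner_comm v w]
  ring

theorem trace_tangentProj {n : ℕ} {w : Amb n} (hw : ‖w‖ = 1) :
    LinearMap.trace ℝ (Amb n) (tangentProj w).toLinearMap = n := by
  have h : (tangentProj w).toLinearMap =
      LinearMap.id - (innerSL ℝ w).toLinearMap.smulRight w := rfl
  rw [h, map_sub, LinearMap.trace_id, LinearMap.trace_smulRight]
  simp [hw]

/-- Replacing the ambient gradient by its tangential part costs a multiple of the second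
fundamental form; this is the Gauss formula for the Hessian on a hypersurface. -/
theorem surfaceLaplacian_eq {n : ℕ} {ν : Amb n → Amb n} {φ : Amb n → ℝ} {p : Amb n}
    (hν : DifferentiableAt ℝ ν p) (hu : ‖ν p‖ = 1) (hφ : DifferentiableAt ℝ (gradient φ) p) :
    surfaceLaplacian ν φ p =
      surfaceDiv ν (gradient φ) p - ⟪ν p, gradient φ p⟫_ℝ * meanCurvature ν p := by
  have hfd : tangentDeriv ν (surfaceGrad ν φ) p =
      tangentDeriv ν (gradient φ) p - ⟪ν p, gradient φ p⟫_ℝ • tangentDeriv ν ν p := by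
    have hs : surfaceGrad ν φ = fun q => gradient φ q - ⟪ν q, gradient φ q⟫_ℝ • ν q := rfl
    have hi : DifferentiableAt ℝ (fun q => ⟪ν q, gradient φ q⟫_ℝ) p := hν.inner ℝ hφ
    ext1 v
    rw [tangentDeriv, hs, fderiv_fun_sub hφ (hi.fun_smul hν), fderiv_fun_smul hi hν]
    simp [tangentDeriv, tangentProj_self hu]
  rw [surfaceLaplacian, surfaceDiv, hfd, surfaceDiv, meanCurvature, surfaceDiv]
  simp

theorem hasGradientAt_radial {n : ℕ} {h : ℝ → ℝ} {x : Amb n} {d : ℝ}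
    (hd : HasDerivAt h d (‖x‖ ^ 2)) :
    HasGradientAt (fun y : Amb n => h (‖y‖ ^ 2)) ((2 * d) • x) x := by
  rw [hasGradientAt_iff_hasFDerivAt]
  refine (hd.comp_hasFDerivAt x (hasStrictFDerivAt_norm_sq x).hasFDerivAt).congr_fderiv ?_
  ext v
  simp
  ring

/-- On a hypersurface whose mean curvature is `½ ⟪x, ν⟫`, the normal part of `½ ⟪x, Dφ⟫` cancels
the mean curvature term of `Δ φ`; no derivative of `ν` is left in `L φ` apart from `|A|²`. -/
theorem stabilityOp_radial {n : ℕ} {ν : Amb n → Amb n} {p : Amb n} {h : ℝ → ℝ}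
    (hν : DifferentiableAt ℝ ν p) (hu : ‖ν p‖ = 1)
    (hH : meanCurvature ν p = 1 / 2 * ⟪p, ν p⟫_ℝ) (hh : ContDiff ℝ ∞ h) :
    stabilityOp ν (fun x => h (‖x‖ ^ 2)) p =
      (2 * n - ‖p‖ ^ 2) * deriv h (‖p‖ ^ 2)
        + 4 * deriv (deriv h) (‖p‖ ^ 2) * ‖tangentProj (ν p) p‖ ^ 2
        + (normSqA ν p + 1 / 2) * h (‖p‖ ^ 2) := by
  have hd : ∀ s, HasDerivAt h (deriv h s) s := fun s =>
    (hh.differentiable (by simp) s).hasDerivAt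
  have hd' : ∀ s, HasDerivAt (deriv h) (deriv (deriv h) s) s := fun s =>
    (((contDiff_infty_iff_deriv.1 hh).2).differentiable (by simp) s).hasDerivAt
  have hgrad : gradient (fun x : Amb n => h (‖x‖ ^ 2)) = fun x => (2 * deriv h (‖x‖ ^ 2)) • x :=
    gradient_eq fun x => hasGradientAt_radial (hd _)
  have hfd : HasFDerivAt (fun x : Amb n => (2 * deriv h (‖x‖ ^ 2)) • x)
      ((2 * deriv h (‖p‖ ^ 2)) • ContinuousLinearMap.id ℝ (Amb n) +
        ((4 * deriv (deriv h) (‖p‖ ^ 2)) • innerSL ℝ p).smulRight p) p := by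
    refine ((((hd' _).comp_hasFDerivAt p
      (hasStrictFDerivAt_norm_sq p).hasFDerivAt).const_mul 2).smul
        (hasFDerivAt_id p)).congr_fderiv ?_
    ext1 v
    simp
    congr 1
    ring
  have hdiv : surfaceDiv ν (gradient (fun x : Amb n => h (‖x‖ ^ 2))) p =
      2 * deriv h (‖p‖ ^ 2) * n
        + 4 * deriv (deriv h) (‖p‖ ^ 2) * ‖tangentProj (ν p) p‖ ^ 2 := by
    have ht : (tangentDeriv ν (gradient (fun x : Amb n => h (‖x‖ ^ 2))) p).toLinearMap =
        (2 * deriv h (‖p‖ ^ 2)) • (tangentProj (ν p)).toLinearMap +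
        (4 * deriv (deriv h) (‖p‖ ^ 2)) •
          (innerSL ℝ (tangentProj (ν p) p)).toLinearMap.smulRight (tangentProj (ν p) p) := by
      rw [tangentDeriv, hgrad, hfd.fderiv]
      ext1 v
      simp [tangentProj_tangentProj hu, inner_tangentProj_comm, mul_smul]
    rw [surfaceDiv, ht, map_add, map_smul, map_smul, trace_tangentProj hu,
      LinearMap.trace_smulRight]
    simp
  rw [stabilityOp, surfaceLaplacian_eq hν hu (by rw [hgrad]; exact hfd.differentiableAt), hdiv, hH,
    surfaceGrad, hgrad, map_smul, inner_smul_right, inner_smul_right, inner_tangentProj_comm,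
    tangentProj_apply, inner_sub_left, inner_smul_left, real_inner_self_eq_norm_sq,
    real_inner_comm p (ν p)]
  simp only [RCLike.conj_to_real]
  ring

/-! ### Area bounds from the entropy -/

/-- Compare with the Gaussian at scale `t₀ = R²` centred at the origin, which is at least
`exp (-1/4)` on the ball of radius `R`. -/
theorem area_ball_le {n : ℕ} {S : Set (Amb n)} {lam R : ℝ}
    (hS : entropy S ≤ ENNReal.ofReal lam) (hR : 0 < R) :
    area S (Metric.ball 0 R) ≤
      ENNReal.ofReal (Real.exp (1 / 4) * (4 * Real.pi) ^ ((n : ℝ) / 2) * R ^ n * lam) := by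
  set c : ℝ := (4 * Real.pi * R ^ 2) ^ (-(n : ℝ) / 2) with hc
  set K : ℝ := Real.exp (1 / 4) * (4 * Real.pi) ^ ((n : ℝ) / 2) * R ^ n with hK
  have hK0 : 0 ≤ K := by positivity
  have hc0 : 0 ≤ c := by positivity
  have hKc : K * (c * Real.exp (-(1 / 4))) = 1 := by
    have hRn : (R ^ 2) ^ ((n : ℝ) / 2) = R ^ n := by
      rw [← Real.rpow_natCast R 2, ← Real.rpow_mul hR.le, ← Real.rpow_natCast R n]
      congr 1
      push_cast
      ring
    have hpow : (4 * Real.pi) ^ ((n : ℝ) / 2) * R ^ n * c = 1 := by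
      rw [hc, ← hRn, ← Real.mul_rpow (by positivity) (by positivity), neg_div,
        Real.rpow_neg (by positivity), mul_inv_cancel₀ (by positivity)]
    calc K * (c * Real.exp (-(1 / 4)))
        = ((4 * Real.pi) ^ ((n : ℝ) / 2) * R ^ n * c) *
            (Real.exp (1 / 4) * Real.exp (-(1 / 4))) := by rw [hK]; ring
      _ = 1 := by rw [hpow, ← Real.exp_add]; simp
  have hgauss : ENNReal.ofReal (c * Real.exp (-(1 / 4))) * area S (Metric.ball 0 R) ≤
      ENNReal.ofReal lam := by
    refine le_trans ?_ ((le_iSup₂_of_le (0 : Amb n) (R ^ 2)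
      (le_iSup_of_le (by positivity : 0 < R ^ 2) le_rfl)).trans hS)
    rw [gaussianArea, ENNReal.ofReal_mul hc0, mul_assoc, ← hc]
    gcongr
    rw [← setLIntegral_const]
    refine (setLIntegral_mono' measurableSet_ball fun x hx => ?_).trans
      (setLIntegral_le_lintegral _ _)
    have hx' : ‖x‖ < R := by simpa using hx
    refine ENNReal.ofReal_le_ofReal (Real.exp_le_exp.2 ?_)
    rw [sub_zero, neg_div, neg_le_neg_iff, div_le_div_iff₀ (by positivity) (by norm_num)]
    nlinarith [norm_nonneg x]
  calc area S (Metric.ball 0 R)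
      = ENNReal.ofReal K *
          (ENNReal.ofReal (c * Real.exp (-(1 / 4))) * area S (Metric.ball 0 R)) := by
        rw [← mul_assoc, ← ENNReal.ofReal_mul hK0, hKc]
        simp
    _ ≤ ENNReal.ofReal K * ENNReal.ofReal lam := by gcongr
    _ = _ := (ENNReal.ofReal_mul hK0).symm

/-! ### Radial cutoff functions -/

theorem deriv_eq_zero_of_eqOn_isOpen {f : ℝ → ℝ} {U : Set ℝ} (hU : IsOpen U) {c : ℝ}
    (hf : ∀ y ∈ U, f y = c) {y : ℝ} (hy : y ∈ U) : deriv f y = 0 := by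
  have h : f =ᶠ[𝓝 y] fun _ => c := by
    filter_upwards [hU.mem_nhds hy] with z hz using hf z hz
  rw [h.deriv_eq, deriv_const]

theorem exists_abs_le_of_eq_zero_off_Icc {f : ℝ → ℝ} (hf : Continuous f) {a b : ℝ}
    (h0 : ∀ y < a, f y = 0) (h1 : ∀ y > b, f y = 0) : ∃ M, ∀ y, |f y| ≤ M := by
  obtain ⟨M, hM⟩ := (isCompact_Icc (a := a) (b := b)).exists_bound_of_continuousOn hf.continuousOn
  refine ⟨max M 0, fun y => ?_⟩
  rcases lt_or_ge y a with hy | hy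
  · simp [h0 y hy]
  rcases lt_or_ge b y with hy' | hy'
  · simp [h1 y hy']
  · exact (hM y ⟨hy, hy'⟩).trans (le_max_left _ _)

/-- Profiles `h` such that `x ↦ h (‖x‖²)` cuts off between the radii `R - 1/4` and `R - 1/8`, with
bounds on two derivatives independent of `R`. -/
theorem exists_radial_cutoff : ∃ M : ℝ, ∀ R : ℝ, 1 < R → ∃ h : ℝ → ℝ, ContDiff ℝ ∞ h ∧
    (∀ s, 0 ≤ h s ∧ h s ≤ 1) ∧ (∀ s, (R - 1 / 8) ^ 2 ≤ s → h s = 0) ∧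
    (∀ s, s ≤ (R - 1 / 4) ^ 2 → h s = 1 ∧ deriv h s = 0 ∧ deriv (deriv h) s = 0) ∧
    ∀ s, |deriv h s| ≤ M ∧ |deriv (deriv h) s| ≤ M := by
  set T := Real.smoothTransition
  have hT : ContDiff ℝ ∞ T := Real.smoothTransition.contDiff
  have hT' : ContDiff ℝ ∞ (deriv T) := (contDiff_infty_iff_deriv.1 hT).2
  have hT'' : ContDiff ℝ ∞ (deriv (deriv T)) := (contDiff_infty_iff_deriv.1 hT').2
  have l0 : ∀ y ∈ Iio (0 : ℝ), deriv T y = 0 := fun y hy =>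
    deriv_eq_zero_of_eqOn_isOpen isOpen_Iio
      (fun z hz => Real.smoothTransition.zero_of_nonpos (le_of_lt hz)) hy
  have r0 : ∀ y ∈ Ioi (1 : ℝ), deriv T y = 0 := fun y hy =>
    deriv_eq_zero_of_eqOn_isOpen isOpen_Ioi
      (fun z hz => Real.smoothTransition.one_of_one_le (le_of_lt hz)) hy
  have l1 : ∀ y ∈ Iio (0 : ℝ), deriv (deriv T) y = 0 := fun y hy =>
    deriv_eq_zero_of_eqOn_isOpen isOpen_Iio l0 hy
  have r1 : ∀ y ∈ Ioi (1 : ℝ), deriv (deriv T) y = 0 := fun y hy =>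
    deriv_eq_zero_of_eqOn_isOpen isOpen_Ioi r0 hy
  obtain ⟨M₁, hM₁⟩ := exists_abs_le_of_eq_zero_off_Icc hT'.continuous l0 r0
  obtain ⟨M₂, hM₂⟩ := exists_abs_le_of_eq_zero_off_Icc hT''.continuous l1 r1
  refine ⟨max (8 * M₁) (64 * M₂), fun R hR => ?_⟩
  set g : ℝ → ℝ := fun s => 8 * ((R - 1 / 8) ^ 2 - s) with hg
  have hgd : ∀ s, HasDerivAt g (-8) s := fun s =>
    (((hasDerivAt_id s).const_sub ((R - 1 / 8) ^ 2)).const_mul 8).congr_deriv (by norm_num)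
  have hd1 : deriv (fun s => T (g s)) = fun s => deriv T (g s) * -8 := funext fun s =>
    ((hT.differentiable (by simp) (g s)).hasDerivAt.comp s (hgd s)).deriv
  have hd2 : deriv (fun s => deriv T (g s) * -8) = fun s => deriv (deriv T) (g s) * 64 :=
    funext fun s => (((hT'.differentiable (by simp) (g s)).hasDerivAt.comp s
      (hgd s)).mul_const (-8)).deriv.trans (by ring)
  refine ⟨fun s => T (g s), hT.comp (by fun_prop),
    fun s => ⟨Real.smoothTransition.nonneg _, Real.smoothTransition.le_one _⟩,
    fun s hs => Real.smoothTransition.zero_of_nonpos (by simp only [hg]; linarith),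
    fun s hs => ?_, fun s => ?_⟩
  · -- `8 ((R - 1/8)² - (R - 1/4)²) = 2 R - 3/8 > 1`
    have hgs : 1 < g s := by simp only [hg]; nlinarith
    rw [hd1, hd2]
    exact ⟨Real.smoothTransition.one_of_one_le hgs.le, by simp [r0 _ hgs], by simp [r1 _ hgs]⟩
  · rw [hd1, hd2]
    simp only [abs_mul, abs_neg, Nat.abs_ofNat]
    exact ⟨le_max_of_le_left (by linarith [hM₁ (g s)]),
      le_max_of_le_right (by linarith [hM₂ (g s)])⟩

/-! ### The curvature estimate -/

/-- The gap between the Gaussian weights at the radii `R - 1` and `R - 1/4` is of order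
`exp (-3R/8)`; the excess over `exp (-R/4)` absorbs the factor `R²`. -/
theorem sq_mul_exp_le {R : ℝ} (hR : 0 ≤ R) :
    R ^ 2 * (Real.exp ((R - 1) ^ 2 / 4) * Real.exp (-(R - 1 / 4) ^ 2 / 4)) ≤
      128 * Real.exp 1 * Real.exp (-R / 4) := by
  have h : R ^ 2 ≤ 128 * Real.exp (R / 8) := by
    have := Real.quadratic_le_exp_of_nonneg (x := R / 8) (by positivity)
    nlinarith
  rw [← Real.exp_add]
  calc R ^ 2 * Real.exp ((R - 1) ^ 2 / 4 + -(R - 1 / 4) ^ 2 / 4)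
      ≤ 128 * Real.exp (R / 8) * Real.exp ((R - 1) ^ 2 / 4 + -(R - 1 / 4) ^ 2 / 4) := by gcongr
    _ = 128 * Real.exp (R / 8 + ((R - 1) ^ 2 / 4 + -(R - 1 / 4) ^ 2 / 4)) := by
        rw [mul_assoc, ← Real.exp_add]
    _ ≤ 128 * Real.exp (1 + -R / 4) :=
        mul_le_mul_of_nonneg_left (Real.exp_le_exp.2 (by nlinarith)) (by norm_num)
    _ = _ := by rw [Real.exp_add, mul_assoc]

theorem normSqA_nonneg {n : ℕ} (ν : Amb n → Amb n) (p : Amb n) : 0 ≤ normSqA ν p :=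
  Finset.sum_nonneg fun _ _ => by positivity

/-- The stability operator of a self-shrinker on a radial function. -/
theorem IsSelfShrinker.exists_stabilityOperator_radial {n : ℕ} {S : Set (Amb n)}
    (hS : IsSelfShrinker S) {p : Amb n} (hp : p ∈ S) {h : ℝ → ℝ} (hh : ContDiff ℝ ∞ h) :
    ∃ τ, 0 ≤ τ ∧ τ ≤ ‖p‖ ^ 2 ∧ stabilityOperator S (fun x => h (‖x‖ ^ 2)) p =
      (2 * n - ‖p‖ ^ 2) * deriv h (‖p‖ ^ 2) + 4 * deriv (deriv h) (‖p‖ ^ 2) * τ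
        + (sqNormSecondFundForm S p + 1 / 2) * h (‖p‖ ^ 2) := by
  have hν := hS.hypersurface.isLocalUnitNormal_localNormal hp
  have hu : ‖localNormal S p p‖ = 1 := hν.unit.self_of_nhdsWithin hp
  refine ⟨‖tangentProj (localNormal S p p) p‖ ^ 2, by positivity, ?_,
    stabilityOp_radial (hν.smooth.differentiableAt (by simp)) hu (hS.shrinker p hp _ hν) hh⟩
  rw [norm_tangentProj_sq hu]
  linarith [sq_nonneg ⟪localNormal S p p, p⟫_ℝ]

/-- Stability is tested on the cutoff `φ = h (‖x‖²)`. The integrand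
`K = -φ Lφ ρ + ½ φ² ρ` equals `-|A|² ρ` on the ball of radius `R - 1/4`, where `φ = 1`, and is
bounded above on the remaining shell, so `0 ≤ ∫ K` bounds `∫ |A|² ρ` on the ball by the integral
over the shell. -/
theorem lintegral_ball_le_of_stable {n : ℕ} {S : Set (Amb n)} {R M : ℝ} (hS : IsSelfShrinker S)
    (hR : 1 < R) (hstab : IsStableIn S (1 / 2) (Metric.ball 0 R))
    (hfin : area S (Metric.ball 0 R) ≠ ⊤) {h : ℝ → ℝ} (hh : ContDiff ℝ ∞ h)
    (h01 : ∀ s, 0 ≤ h s ∧ h s ≤ 1) (hout : ∀ s, (R - 1 / 8) ^ 2 ≤ s → h s = 0)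
    (hin : ∀ s, s ≤ (R - 1 / 4) ^ 2 → h s = 1 ∧ deriv h s = 0 ∧ deriv (deriv h) s = 0)
    (hM : ∀ s, |deriv h s| ≤ M ∧ |deriv (deriv h) s| ≤ M) :
    ∫⁻ x in Metric.closedBall 0 (R - 1), ENNReal.ofReal (sqNormSecondFundForm S x) ∂(area S) ≤
      ENNReal.ofReal (Real.exp ((R - 1) ^ 2 / 4) *
        ((2 * n + 5) * M * R ^ 2 * Real.exp (-(R - 1 / 4) ^ 2 / 4) *
          (area S).real (Metric.ball 0 R))) := by
  set μ := area S with hμ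
  set φ : Amb n → ℝ := fun x => h (‖x‖ ^ 2) with hφ
  set B : ℝ := (2 * n + 5) * M * R ^ 2 * Real.exp (-(R - 1 / 4) ^ 2 / 4) with hB
  set D : Set (Amb n) := Metric.closedBall 0 (R - 1) with hD
  have hM0 : 0 ≤ M := (abs_nonneg _).trans (hM 0).1
  have hB0 : 0 ≤ B := by positivity
  have hφs : ContDiff ℝ ∞ φ := hh.comp (contDiff_norm_sq ℝ)
  have hφ0 : ∀ x : Amb n, R - 1 / 8 ≤ ‖x‖ → φ x = 0 := fun x hx =>
    hout _ (by nlinarith [norm_nonneg x])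
  have htsub : tsupport φ ⊆ Metric.closedBall 0 (R - 1 / 8) := by
    refine closure_minimal (fun x hx => ?_) Metric.isClosed_closedBall
    by_contra hx'
    rw [mem_closedBall_zero_iff, not_le] at hx'
    exact hx (hφ0 x hx'.le)
  have hcomp : HasCompactSupport φ :=
    (isCompact_closedBall (0 : Amb n) (R - 1 / 8)).of_isClosed_subset (isClosed_tsupport _) htsub
  obtain ⟨hFint, hpos⟩ := hstab φ hφs hcomp
    (htsub.trans (Metric.closedBall_subset_ball (by linarith)))
  have hGint : Integrable (fun x => φ x ^ 2 * weight x) μ := by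
    have hsupp : Function.support (fun x => φ x ^ 2 * weight x) ⊆ Metric.ball 0 R := by
      intro x hx
      by_contra hx'
      exact hx (by
        have : φ x = 0 := hφ0 x (by
          have : R ≤ ‖x‖ := by simpa using hx'
          linarith)
        simp [this])
    rw [← integrableOn_iff_integrable_of_support_subset hsupp]
    have hcont : Continuous fun x : Amb n => φ x ^ 2 * weight x := by
      have := hφs.continuous
      unfold weight
      fun_prop
    refine Measure.integrableOn_of_bounded (M := 1) hfin hcont.aestronglyMeasurable
      (Eventually.of_forall fun x => ?_)
    have hw : weight x ≤ 1 := Real.exp_le_one_iff.2 (by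
      rw [neg_div]
      exact neg_nonpos.2 (by positivity))
    have hw0 : 0 ≤ weight x := (Real.exp_pos _).le
    have h2 : φ x ^ 2 ≤ 1 := pow_le_one₀ (h01 _).1 (h01 _).2
    rw [Real.norm_of_nonneg (by positivity)]
    exact mul_le_one₀ h2 hw0 hw
  -- The term `½ φ` of `L φ` and the stability constant `½` cancel in `K`.
  set K : Amb n → ℝ := fun x =>
    -φ x * stabilityOperator S φ x * weight x + 1 / 2 * (φ x ^ 2 * weight x) with hK
  have hKint : Integrable K μ := hFint.add (hGint.const_mul _)
  have hKpos : 0 ≤ ∫ x, K x ∂μ := by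
    rw [hK, integral_add hFint (hGint.const_mul _), integral_const_mul]
    exact hpos
  have hKin : ∀ x ∈ S, ‖x‖ ≤ R - 1 / 4 → K x = -(sqNormSecondFundForm S x * weight x) := by
    intro x hxS hx
    obtain ⟨τ, -, -, hst⟩ := hS.exists_stabilityOperator_radial hxS hh
    obtain ⟨e0, e1, e2⟩ := hin (‖x‖ ^ 2) (by nlinarith [norm_nonneg x])
    simp only [hK, hφ]
    rw [hst, e0, e1, e2]
    ring
  have hA : ∀ x, 0 ≤ sqNormSecondFundForm S x := fun x => normSqA_nonneg _ _
  have hKle : ∀ x ∈ S, K x ≤ (Metric.ball (0 : Amb n) R).indicator (fun _ => B) x := by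
    intro x hxS
    have hw0 : 0 ≤ weight x := (Real.exp_pos _).le
    have hind : 0 ≤ (Metric.ball (0 : Amb n) R).indicator (fun _ => B) x :=
      indicator_nonneg (fun _ _ => hB0) _
    rcases le_or_gt ‖x‖ (R - 1 / 4) with hx | hx
    · rw [hKin x hxS hx]
      exact le_trans (neg_nonpos.2 (mul_nonneg (hA x) hw0)) hind
    rcases le_or_gt R ‖x‖ with hx' | hx'
    · refine le_trans (le_of_eq ?_) hind
      simp [hK, hφ0 x (by linarith)]
    rw [indicator_of_mem (by simpa using hx')]
    obtain ⟨τ, hτ0, hτ, hst⟩ := hS.exists_stabilityOperator_radial hxS hh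
    obtain ⟨m1, m2⟩ := hM (‖x‖ ^ 2)
    obtain ⟨p0, p1⟩ := h01 (‖x‖ ^ 2)
    have hx2 : ‖x‖ ^ 2 ≤ R ^ 2 := by nlinarith [norm_nonneg x]
    have hw : weight x ≤ Real.exp (-(R - 1 / 4) ^ 2 / 4) := Real.exp_le_exp.2 (by nlinarith)
    -- `E` is the drift Laplacian of `φ` at `x`.
    set E : ℝ := (2 * n - ‖x‖ ^ 2) * deriv h (‖x‖ ^ 2) + 4 * deriv (deriv h) (‖x‖ ^ 2) * τ
    have hE : -E ≤ (2 * n + 5) * M * R ^ 2 := by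
      have b1 : |2 * (n : ℝ) - ‖x‖ ^ 2| ≤ (2 * n + 1) * R ^ 2 := by
        rw [abs_le]
        have hn0 : (0 : ℝ) ≤ n := n.cast_nonneg
        constructor <;> nlinarith [mul_nonneg hn0 (by nlinarith : 0 ≤ R ^ 2 - 1), sq_nonneg ‖x‖]
      have b2 : |4 * τ| ≤ 4 * R ^ 2 := by
        rw [abs_of_nonneg (by positivity)]
        linarith
      calc -E ≤ |E| := neg_le_abs E
        _ ≤ |(2 * n - ‖x‖ ^ 2) * deriv h (‖x‖ ^ 2)| + |4 * deriv (deriv h) (‖x‖ ^ 2) * τ| :=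
          abs_add_le _ _
        _ = |2 * (n : ℝ) - ‖x‖ ^ 2| * |deriv h (‖x‖ ^ 2)|
            + |4 * τ| * |deriv (deriv h) (‖x‖ ^ 2)| := by
          rw [abs_mul, mul_right_comm, abs_mul (4 * τ)]
        _ ≤ (2 * n + 1) * R ^ 2 * M + 4 * R ^ 2 * M := by gcongr
        _ = _ := by ring
    have hKx : K x = h (‖x‖ ^ 2) * -E * weight x
        - sqNormSecondFundForm S x * h (‖x‖ ^ 2) ^ 2 * weight x := by
      simp only [hK, hφ]
      rw [hst]
      ring
    have hlast : 0 ≤ sqNormSecondFundForm S x * h (‖x‖ ^ 2) ^ 2 * weight x :=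
      mul_nonneg (mul_nonneg (hA x) (sq_nonneg _)) hw0
    have hfirst : h (‖x‖ ^ 2) * -E ≤ (2 * n + 5) * M * R ^ 2 :=
      (mul_le_mul_of_nonneg_left hE p0).trans (mul_le_of_le_one_left (by positivity) p1)
    have hprod : h (‖x‖ ^ 2) * -E * weight x ≤ B :=
      (mul_le_mul_of_nonneg_right hfirst hw0).trans
        (mul_le_mul_of_nonneg_left hw (by positivity))
    linarith
  -- Measurability of `|A|²` is never needed: on `D` it is a continuous multiple of `K`.
  have hDm : MeasurableSet D := Metric.isClosed_closedBall.measurableSet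
  have hSae : ∀ᵐ x ∂μ, x ∈ S := ae_restrict_mem hS.hypersurface.measurableSet
  have hDin : ∀ x ∈ D, ‖x‖ ≤ R - 1 := fun x hx => by simpa [hD] using hx
  have hnonneg : 0 ≤ᵐ[μ.restrict D] fun x => -K x := by
    filter_upwards [ae_restrict_of_ae hSae, ae_restrict_mem hDm] with x hxS hxD
    rw [hKin x hxS (by linarith [hDin x hxD]), neg_neg]
    exact mul_nonneg (hA x) (Real.exp_pos _).le
  have hIB : Integrable ((Metric.ball (0 : Amb n) R).indicator fun _ => B) μ :=
    (integrable_indicator_iff measurableSet_ball).2 (integrableOn_const hfin)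
  have hKneg : Integrable (fun x => -K x) (μ.restrict D) := hKint.integrableOn.neg
  have hmain : ∫ x in D, -K x ∂μ ≤ B * μ.real (Metric.ball 0 R) := by
    have hsplit := integral_add_compl hDm hKint
    have hcompl : ∫ x in Dᶜ, K x ∂μ ≤ B * μ.real (Metric.ball 0 R) := by
      calc ∫ x in Dᶜ, K x ∂μ
          ≤ ∫ x in Dᶜ, (Metric.ball (0 : Amb n) R).indicator (fun _ => B) x ∂μ :=
            integral_mono_ae hKint.integrableOn hIB.integrableOn
              (ae_restrict_of_ae (hSae.mono hKle))
        _ ≤ ∫ x, (Metric.ball (0 : Amb n) R).indicator (fun _ => B) x ∂μ :=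
            setIntegral_le_integral hIB
              (Eventually.of_forall fun x => indicator_nonneg (fun _ _ => hB0) x)
        _ = B * μ.real (Metric.ball 0 R) := by
            rw [integral_indicator measurableSet_ball, setIntegral_const, smul_eq_mul, mul_comm]
    rw [integral_neg]
    linarith
  calc ∫⁻ x in D, ENNReal.ofReal (sqNormSecondFundForm S x) ∂μ
      ≤ ∫⁻ x in D, ENNReal.ofReal (Real.exp ((R - 1) ^ 2 / 4) * -K x) ∂μ := by
        refine lintegral_mono_ae ?_
        filter_upwards [ae_restrict_of_ae hSae, ae_restrict_mem hDm] with x hxS hxD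
        refine ENNReal.ofReal_le_ofReal ?_
        rw [hKin x hxS (by linarith [hDin x hxD]), neg_neg, mul_left_comm]
        refine le_mul_of_one_le_right (hA x) ?_
        rw [weight, ← Real.exp_add]
        exact Real.one_le_exp (by nlinarith [hDin x hxD, norm_nonneg x])
    _ = ENNReal.ofReal (Real.exp ((R - 1) ^ 2 / 4) * ∫ x in D, -K x ∂μ) := by
        rw [← integral_const_mul, ofReal_integral_eq_lintegral_ofReal
          (hKneg.const_mul _)]
        filter_upwards [hnonneg] with x hx
        exact mul_nonneg (Real.exp_pos _).le hx
    _ ≤ _ := by gcongr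

end Shrinker

theorem mainTheorem5 (n : ℕ) (hn : 2 ≤ n) (lam₀ : ℝ) :
    ∃ C : ℝ, ∀ (S : Set (Shrinker.Amb n)) (R : ℝ), Shrinker.IsSelfShrinker S →
      Shrinker.entropy S ≤ ENNReal.ofReal lam₀ →
      1 < R → Shrinker.IsStableIn S (1 / 2) (Metric.ball 0 R) →
      ∫⁻ x in Metric.closedBall 0 (R - 1),
          ENNReal.ofReal (Shrinker.sqNormSecondFundForm S x) ∂(Shrinker.area S) ≤
        ENNReal.ofReal (C * R ^ n * Real.exp (-R / 4)) := by
  obtain ⟨M, hcut⟩ := Shrinker.exists_radial_cutoff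
  refine ⟨(2 * n + 5) * M * (128 * Real.exp 1) *
    (Real.exp (1 / 4) * (4 * Real.pi) ^ ((n : ℝ) / 2) * max lam₀ 0),
    fun S R hS hent hR hstab => ?_⟩
  obtain ⟨h, hh, h01, hout, hin, hM⟩ := hcut R hR
  have hM0 : 0 ≤ M := (abs_nonneg _).trans (hM 0).1
  have hR0 : 0 < R := by linarith
  have harea := Shrinker.area_ball_le
    (hent.trans (ENNReal.ofReal_le_ofReal (le_max_left lam₀ 0))) hR0
  have hreal := ENNReal.toReal_le_of_le_ofReal (by positivity) harea
  refine (Shrinker.lintegral_ball_le_of_stable hS hR hstab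
    (ne_top_of_le_ne_top ENNReal.ofReal_ne_top harea) hh h01 hout hin hM).trans
    (ENNReal.ofReal_le_ofReal ?_)
  set V : ℝ := Real.exp (1 / 4) * (4 * Real.pi) ^ ((n : ℝ) / 2)
  calc Real.exp ((R - 1) ^ 2 / 4) * ((2 * n + 5) * M * R ^ 2 * Real.exp (-(R - 1 / 4) ^ 2 / 4) *
        (Shrinker.area S).real (Metric.ball 0 R))
      = (2 * n + 5) * M *
          (R ^ 2 * (Real.exp ((R - 1) ^ 2 / 4) * Real.exp (-(R - 1 / 4) ^ 2 / 4))) *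
          (Shrinker.area S).real (Metric.ball 0 R) := by ring
    _ ≤ (2 * n + 5) * M * (128 * Real.exp 1 * Real.exp (-R / 4)) *
          (V * R ^ n * max lam₀ 0) := by
        exact mul_le_mul (mul_le_mul_of_nonneg_left (Shrinker.sq_mul_exp_le hR0.le)
          (by positivity)) hreal measureReal_nonneg (by positivity)
    _ = _ := by ring
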